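/- All graphs are finite, undirected and simple. For a real $\rho\ge 1$, an edge coloring of a graph (with any number of colors, not necessarily proper) is called $\rho$-mean if the average, over all vertices $v$, of the number of distinct colors appearing on edges incident with $v$ is at most $\rho$. For a graph $H$, let $RT(n,H,\rho\text{-mean})$ be the maximum number of edges of a graph on $n$ vertices that has a $\rho$-mean edge coloring without a monochromatic copy of $H$ (as a not necessarily induced subgraph); if no such graph exists, which can happen only when $H$ has no edges, set $RT(n,H,\rho\text{-mean})=0$. Let $\chi(H)$ be the chromatic number of $H$. **Theorem.** For every real $\rho\ge 1$ and every graph $H$, as $n\to\infty$, $$RT(n,H,\rho\text{-mean})\le RT(n,K_{\chi(H)},\rho\text{-mean})+o(n^2).$$ Moreover, if the clique number of $H$ equals its chromatic number, then $$RT(n,H,\rho\text{-mean})= RT(n,K_{\chi(H)},\rho\text{-mean})+o(n^2).$$ Here the $o(n^2)$ terms may depend on $H$ and $\rho$. -/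

import Mathlib

open Asymptotics Filter

namespace MeanRamseyTuran

/-- The set of colors appearing on the edges incident with the vertex `v`. Colors are natural
numbers, which is no restriction since a finite graph uses finitely many colors. -/
def colorsAt {V : Type*} {G : SimpleGraph V} (C : G.EdgeLabeling ℕ) (v : V) : Set ℕ :=
  {c | ∃ w, (C.labelGraph c).Adj v w}

/-- The edge coloring `C` is `ρ`-mean: the average over all vertices of the number of colors
incident with a vertex is at most `ρ` (multiplied out by the number of vertices). -/
def IsMean {V : Type*} [Fintype V] {G : SimpleGraph V} (ρ : ℝ) (C : G.EdgeLabeling ℕ) : Prop :=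
  ∑ v : V, ((colorsAt C v).ncard : ℝ) ≤ ρ * Fintype.card V

/-- The edge coloring `C` has a monochromatic copy of `H`: for some color, `H` is isomorphic to a
(not necessarily induced) subgraph of the graph formed by the edges of that color. -/
def HasMonoCopy {V W : Type*} {G : SimpleGraph V} (C : G.EdgeLabeling ℕ) (H : SimpleGraph W) :
    Prop :=
  ∃ c : ℕ, H.IsContained (C.labelGraph c)

/-- The mean Ramsey-Turán number `RT(n, H, ρ-mean)`: the maximum number of edges of a graph on `n`
vertices having a `ρ`-mean edge coloring with no monochromatic copy of `H` (and `0` if there is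
no such graph, which for `ρ ≥ 0` happens only if `H` has no edges). -/
noncomputable def RT {W : Type*} (n : ℕ) (H : SimpleGraph W) (ρ : ℝ) : ℕ :=
  sSup {m : ℕ | ∃ (G : SimpleGraph (Fin n)) (C : G.EdgeLabeling ℕ),
    IsMean ρ C ∧ ¬ HasMonoCopy C H ∧ G.edgeSet.ncard = m}

end MeanRamseyTuran

/-! In a coloring without a monochromatic `H`, every color class is `H`-free, so the removal lemma
makes it `K_χ(H)`-free at a cost of at most `d² n²` edges. The number of colors is unbounded, so
these costs cannot simply be added up. But a color seen by `s` vertices has at most `s²` edges, so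
its loss is at most `min (d² n²) (s²) ≤ d n s`. Meanness bounds the sum of all `s` by `ρ n`, and the
total loss is at most `d ρ n²` (`ncard_edgeSet_le_of_isMean`). The removal lemma
(`Colorable.exists_le_completeGraph_free`) comes from Szemerédi regularity and a greedy embedding.
If the clique number equals `χ(H)`, then `H` contains `K_χ(H)` and monotonicity (`RT_mono`) gives
the reverse inequality. -/

namespace SimpleGraph

open Finset Fintype

/-! ### Greedy embedding into uniform pairs -/

section Embedding

variable {V W : Type*} {G : SimpleGraph V} [DecidableRel G.Adj] {η a : ℝ}

/-- In a uniform pair, few vertices of one side have few neighbours in a large subset of the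
other side. -/
lemma IsUniform.card_filter_card_filter_adj_lt_le {s t s' t' : Finset V}
    (hst : G.IsUniform η s t) (hd : a + η ≤ G.edgeDensity s t) (hs : s' ⊆ s) (ht : t' ⊆ t)
    (ht' : (#t : ℝ) * η ≤ #t') (ha : 0 ≤ a) :
    (#{x ∈ s' | (#{y ∈ t' | G.Adj x y} : ℝ) < a * #t'} : ℝ) ≤ η * #s := by
  classical
  set B := {x ∈ s' | (#{y ∈ t' | G.Adj x y} : ℝ) < a * #t'} with hB
  by_contra! h
  -- Otherwise `B` and `t'` are large enough for uniformity to apply, yet their density is at most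
  -- `a`.
  have hdens := hst ((filter_subset _ _).trans hs) ht (by rw [mul_comm]; exact h.le) ht'
  have hle : (G.edgeDensity B t' : ℝ) ≤ a := by
    rw [edgeDensity_def]
    push_cast
    refine div_le_of_le_mul₀ (by positivity) ha ?_
    have : (#(G.interedges B t') : ℝ) ≤ ∑ x ∈ B, (#{y ∈ t' | G.Adj x y} : ℝ) := by
      have := (card_le_card <| subset_of_eq (Rel.interedges_eq_biUnion G.Adj (s := B)
        (t := t'))).trans card_biUnion_le
      simp_rw [card_map] at this
      exact_mod_cast this
    refine this.trans ((sum_le_card_nsmul _ _ _ fun x hx ↦ (mem_filter.1 hx).2.le).trans ?_)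
    rw [nsmul_eq_mul]
    exact le_of_eq (by ring)
  rw [abs_sub_lt_iff] at hdens
  linarith

/-- The greedy step of the embedding lemma: vertices of `H` that are still to be embedded have
large candidate sets `A w`, and `T` is the set of vertices already used. -/
lemma exists_injOn_of_isUniform [Fintype W] [DecidableEq V] {H : SimpleGraph W} {U : W → Finset V}
    (ha₀ : 0 < a) (ha₁ : a ≤ 1) (hη : 0 < η) (hU : ∀ w, 1 ≤ η * #(U w))
    (hηa : (2 * card W + 1) * η ≤ a ^ card W)
    (huni : ∀ w w', H.Adj w w' → G.IsUniform η (U w) (U w'))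
    (hd : ∀ w w', H.Adj w w' → a + η ≤ G.edgeDensity (U w) (U w'))
    (S : Finset W) (A : W → Finset V) (T : Finset V) (hAU : ∀ w ∈ S, A w ⊆ U w)
    (hA : ∀ w ∈ S, a ^ (card W - #S) * #(U w) ≤ #(A w)) (hT : #T + #S ≤ card W) :
    ∃ f : W → V, Set.InjOn f S ∧ (∀ w ∈ S, f w ∈ A w ∧ f w ∉ T) ∧
      ∀ w ∈ S, ∀ w' ∈ S, H.Adj w w' → G.Adj (f w) (f w') := by
  classical
  induction S using Finset.induction_on generalizing A T with
  | empty =>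
    rcases isEmpty_or_nonempty W with h | ⟨⟨w₀⟩⟩
    · exact ⟨fun w ↦ h.elim w, by simp, by simp, by simp⟩
    · have : (U w₀).Nonempty := by
        rw [nonempty_iff_ne_empty]
        intro h
        have := hU w₀
        simp [h] at this
        linarith
      exact ⟨fun _ ↦ this.choose, by simp, by simp, by simp⟩
  | insert w₀ S hw₀ ih =>
    rw [card_insert_of_notMem hw₀] at hT hA
    -- Of the factor `2 * card W + 1`, one `card W` pays for bad choices, one for used vertices, and
    -- the 1 leaves a vertex over.
    have hlarge : ∀ w ∈ insert w₀ S, (2 * card W + 1) * η * #(U w) ≤ #(A w) := fun w hw ↦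
      (mul_le_mul_of_nonneg_right (hηa.trans (pow_le_pow_of_le_one ha₀.le ha₁ (Nat.sub_le _ _)))
        (by positivity)).trans (hA w hw)
    let bad : W → Finset V := fun w ↦
      if H.Adj w₀ w then {x ∈ A w₀ | (#{y ∈ A w | G.Adj x y} : ℝ) < a * #(A w)} else ∅
    have hbad : ∀ w ∈ S, (#(bad w) : ℝ) ≤ η * #(U w₀) := by
      intro w hw
      by_cases h : H.Adj w₀ w
      · simp only [bad, if_pos h]
        refine (huni _ _ h).card_filter_card_filter_adj_lt_le (hd _ _ h)
          (hAU _ (mem_insert_self _ _)) (hAU _ (mem_insert_of_mem hw)) ?_ ha₀.le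
        refine le_trans ?_ (hlarge w (mem_insert_of_mem hw))
        have : 0 ≤ (card W : ℝ) * η * #(U w) := by positivity
        nlinarith
      · simp only [bad, if_neg h, Finset.card_empty, Nat.cast_zero]
        positivity
    obtain ⟨v, hv⟩ : (A w₀ \ (S.biUnion bad ∪ T)).Nonempty := by
      rw [sdiff_nonempty]
      intro hsub
      have h₁ : (#(A w₀) : ℝ) ≤ ∑ w ∈ S, (#(bad w) : ℝ) + #T := by
        exact_mod_cast (card_le_card hsub).trans
          ((card_union_le _ _).trans (Nat.add_le_add_right card_biUnion_le _))
      have h₂ : ∑ w ∈ S, (#(bad w) : ℝ) ≤ card W * (η * #(U w₀)) := by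
        refine (sum_le_card_nsmul _ _ _ hbad).trans ?_
        rw [nsmul_eq_mul]
        gcongr
        exact card_le_univ S
      have h₃ : (#T : ℝ) ≤ card W * (η * #(U w₀)) := by
        have h₄ : (#T : ℝ) ≤ card W := by exact_mod_cast (by omega : #T ≤ card W)
        have := mul_le_mul_of_nonneg_left (hU w₀) (Nat.cast_nonneg (α := ℝ) (card W))
        linarith
      have := hlarge w₀ (mem_insert_self _ _)
      have := hU w₀
      nlinarith
    simp only [Finset.mem_sdiff, mem_union, mem_biUnion, not_or, not_exists, not_and] at hv
    obtain ⟨hvA, hvbad, hvT⟩ := hv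
    let A' : W → Finset V := fun w ↦ if H.Adj w₀ w then {y ∈ A w | G.Adj v y} else A w
    have hA'A : ∀ w, A' w ⊆ A w := by
      intro w
      by_cases h : H.Adj w₀ w
      · simp only [A', if_pos h]
        exact filter_subset _ _
      · simp only [A', if_neg h]
        exact Subset.rfl
    obtain ⟨f, hinj, hfA, hadj⟩ := ih A' (insert v T)
      (fun w hw ↦ (hA'A w).trans (hAU w (mem_insert_of_mem hw)))
      (by
        intro w hw
        -- Each embedded vertex shrinks a candidate set by a factor of at least `a`.
        have hpow : a ^ (card W - #S) = a * a ^ (card W - (#S + 1)) := by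
          rw [← pow_succ']
          congr 1
          omega
        have hAw := hA w (mem_insert_of_mem hw)
        rw [hpow, mul_assoc]
        by_cases h : H.Adj w₀ w
        · have := hvbad w hw
          simp only [bad, if_pos h, mem_filter, hvA, true_and, not_lt] at this
          simp only [A', if_pos h]
          exact (mul_le_mul_of_nonneg_left hAw ha₀.le).trans this
        · simp only [A', if_neg h]
          exact (mul_le_of_le_one_left (by positivity) ha₁).trans hAw)
      (by have := card_insert_le v T; omega)
    have hfv : ∀ w ∈ S, f w ≠ v := fun w hw h ↦ (hfA w hw).2 (h ▸ mem_insert_self _ _)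
    have hne : ∀ w ∈ S, w ≠ w₀ := fun w hw h ↦ hw₀ (h ▸ hw)
    have hupd : ∀ w ∈ S, Function.update f w₀ v w = f w := fun w hw ↦
      Function.update_of_ne (hne w hw) _ _
    have hadjv : ∀ w ∈ S, H.Adj w₀ w → G.Adj v (f w) := by
      intro w hw h
      have := (hfA w hw).1
      simp only [A', if_pos h, mem_filter] at this
      exact this.2
    refine ⟨Function.update f w₀ v, ?_, ?_, ?_⟩
    · rw [coe_insert, Set.injOn_insert (by simpa using hw₀)]
      refine ⟨fun w hw w' hw' h ↦ hinj hw hw' ?_, ?_⟩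
      · rwa [hupd w hw, hupd w' hw'] at h
      · rintro ⟨w, hw, h⟩
        rw [hupd w hw, Function.update_self] at h
        exact hfv w hw h
    · intro w hw
      rcases mem_insert.1 hw with rfl | hw
      · rw [Function.update_self]
        exact ⟨hvA, hvT⟩
      · rw [hupd w hw]
        exact ⟨hA'A w (hfA w hw).1, fun h ↦ (hfA w hw).2 (mem_insert_of_mem h)⟩
    · intro w hw w' hw' h
      rcases mem_insert.1 hw with rfl | hwS <;> rcases mem_insert.1 hw' with rfl | hwS'
      · exact (H.irrefl h).elim
      · rw [hupd w' hwS', Function.update_self]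
        exact hadjv w' hwS' h
      · rw [hupd w hwS, Function.update_self]
        exact (hadjv w hwS h.symm).symm
      · rw [hupd w hwS, hupd w' hwS']
        exact hadj w hwS w' hwS' h

/-- **Embedding lemma**: a graph `H` embeds into `G` along large vertex sets that form dense
uniform pairs wherever `H` has an edge. -/
lemma isContained_of_isUniform [Fintype W] {H : SimpleGraph W} {U : W → Finset V}
    (ha₀ : 0 < a) (ha₁ : a ≤ 1) (hη : 0 < η) (hU : ∀ w, 1 ≤ η * #(U w))
    (hηa : (2 * card W + 1) * η ≤ a ^ card W)
    (huni : ∀ w w', H.Adj w w' → G.IsUniform η (U w) (U w'))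
    (hd : ∀ w w', H.Adj w w' → a + η ≤ G.edgeDensity (U w) (U w')) : H.IsContained G := by
  classical
  obtain ⟨f, hinj, -, hadj⟩ := exists_injOn_of_isUniform ha₀ ha₁ hη hU hηa huni hd univ U ∅
    (fun _ _ ↦ Subset.rfl) (by simp [card_univ]) (by simp [card_univ])
  rw [coe_univ, Set.injOn_univ] at hinj
  exact ⟨⟨⟨f, fun {w w'} h ↦ hadj w (mem_univ _) w' (mem_univ _) h⟩, hinj⟩⟩

end Embedding

/-! ### Removal lemma via regularity -/

section Removal

variable {V W : Type*} [Fintype V] [DecidableEq V] {G : SimpleGraph V} [DecidableRel G.Adj]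
  {P : Finpartition (univ : Finset V)} {ε η : ℝ}

lemma filter_adj_not_regularityReduced_adj_subset (δ : ℝ) :
    ({xy : V × V | G.Adj xy.1 xy.2 ∧ ¬(G.regularityReduced P η δ).Adj xy.1 xy.2} :
        Finset (V × V)) ⊆
      (P.nonUniforms G η).biUnion (fun (U, V) ↦ U ×ˢ V) ∪ P.parts.biUnion offDiag ∪
        (P.sparsePairs G δ).biUnion fun (U, V) ↦ G.interedges U V := by
  rintro ⟨x, y⟩
  simp only [mem_filter, regularityReduced_adj, not_and, not_exists,
    not_le, mem_biUnion, mem_union, mem_product, Prod.exists, mem_offDiag, and_imp,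
    or_assoc, and_assoc, P.mk_mem_nonUniforms, Finpartition.mk_mem_sparsePairs, mem_interedges_iff]
  intro _ h h'
  replace h' := h' h
  obtain ⟨U, hU, hx⟩ := P.exists_mem (mem_univ x)
  obtain ⟨V, hV, hy⟩ := P.exists_mem (mem_univ y)
  obtain rfl | hUV := eq_or_ne U V
  · exact Or.inr (Or.inl ⟨U, hU, hx, hy, G.ne_of_adj h⟩)
  by_cases h₂ : G.IsUniform η U V
  · exact Or.inr <| Or.inr ⟨U, V, hU, hV, hUV, h' _ hU _ hV hx hy hUV h₂, hx, hy, h⟩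
  · exact Or.inl ⟨U, V, hU, hV, hUV, h₂, hx, hy⟩

/-- Ordered pairs lost to non-uniform pairs, to the insides of parts and to sparse pairs number at
most `ε/2`, `ε/2` and `ε` times `n²`; halving counts edges. -/
lemma card_edgeFinset_le_card_edgeFinset_regularityReduced_add [Nonempty V] (hη : 0 < η)
    (hηε : η ≤ ε / 8) (hP : P.IsEquipartition) (hPη : P.IsUniform G η) (hP' : 4 / ε ≤ #P.parts) :
    (#G.edgeFinset : ℝ) ≤ #(G.regularityReduced P η (ε / 4)).edgeFinset + ε * card V ^ 2 := by
  have hε : 0 < ε := by linarith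
  let A := (P.nonUniforms G η).biUnion fun (U, V) ↦ U ×ˢ V
  let B := P.parts.biUnion offDiag
  let C := (P.sparsePairs G (ε / 4)).biUnion fun (U, V) ↦ G.interedges U V
  have hcard : 2 * (#G.edgeFinset - #(G.regularityReduced P η (ε / 4)).edgeFinset : ℝ) =
      #{xy : V × V | G.Adj xy.1 xy.2 ∧ ¬(G.regularityReduced P η (ε / 4)).Adj xy.1 xy.2} := by
    rw [mul_sub, filter_and_not, cast_card_sdiff]
    · norm_cast
      rw [two_mul_card_edgeFinset, two_mul_card_edgeFinset]
    · gcongr with xy _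
      exact fun hxy ↦ regularityReduced_le hxy
  have hABC : (#{xy : V × V | G.Adj xy.1 xy.2 ∧
      ¬(G.regularityReduced P η (ε / 4)).Adj xy.1 xy.2} : ℝ) ≤ #A + #B + #C := by
    exact_mod_cast (card_le_card (filter_adj_not_regularityReduced_adj_subset _)).trans
      ((card_union_le _ _).trans (Nat.add_le_add_right (card_union_le _ _) _))
  have hA : (#A : ℝ) < 4 * η * card V ^ 2 := hP.sum_nonUniforms_lt univ_nonempty hη hPη
  have hB : (#B : ℝ) ≤ ε / 2 * card V ^ 2 := hP.card_biUnion_offDiag_le hε hP'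
  have hC : (#C : ℝ) ≤ 4 * (ε / 4) * card V ^ 2 :=
    hP.card_interedges_sparsePairs_le (G := G) (ε := ε / 4) (by positivity)
  have : 4 * η * (card V : ℝ) ^ 2 ≤ 4 * (ε / 8) * card V ^ 2 := by gcongr
  linarith

lemma card_div_two_mul_le_card_of_mem_parts {M : ℕ} (hP : P.IsEquipartition)
    (hM : #P.parts ≤ M) {s : Finset V} (hs : s ∈ P.parts) : (card V : ℝ) / (2 * M) ≤ #s := by
  have hpos : 0 < #P.parts := Finset.Nonempty.card_pos ⟨_, hs⟩
  have hle : #P.parts ≤ card V := P.card_parts_le_card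
  have hdiv : card V ≤ 2 * #P.parts * (card V / #P.parts) := by
    have h₁ := Nat.mod_add_div (card V) #P.parts
    have h₂ := Nat.mod_lt (card V) hpos
    have h₃ := Nat.mul_le_mul_left #P.parts ((Nat.one_le_div_iff hpos).2 hle)
    rw [mul_assoc]
    omega
  calc
    (card V : ℝ) / (2 * M) ≤ card V / (2 * #P.parts) := by gcongr
    _ ≤ ↑(card V / #P.parts) := (div_le_iff₀' (by positivity)).2 <| mod_cast hdiv
    _ ≤ #s := mod_cast hP.average_le_card_part hs

/-- **Removal lemma**: a large graph without a copy of a `k`-colorable graph `H` loses all its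
complete subgraphs on `k` vertices after the deletion of few edges. -/
theorem Colorable.exists_le_completeGraph_free {W : Type*} [Finite W] {H : SimpleGraph W} {k : ℕ}
    (hH : H.Colorable k) {ε : ℝ} (hε : 0 < ε) :
    ∃ N : ℕ, ∀ (V : Type) [Fintype V] (G : SimpleGraph V), N ≤ card V → H.Free G →
      ∃ G' ≤ G, (completeGraph (Fin k)).Free G' ∧
        (G.edgeSet.ncard : ℝ) ≤ G'.edgeSet.ncard + ε * card V ^ 2 := by
  classical
  -- This ensures `a = ε / 8 ≤ 1`; then `a + η ≤ ε / 4`, the density threshold of the reduced graph.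
  wlog hε₁ : ε ≤ 1 generalizing ε
  · obtain ⟨N, hN⟩ := this one_pos le_rfl
    refine ⟨N, fun V _ G hV hG ↦ ?_⟩
    obtain ⟨G', hle, hfree, hcard⟩ := hN V G hV hG
    refine ⟨G', hle, hfree, hcard.trans ?_⟩
    gcongr
    exact (not_le.1 hε₁).le
  cases nonempty_fintype W
  set a := ε / 8 with ha
  have ha₀ : 0 < a := by positivity
  set η := min (ε / 8) (a ^ card W / (2 * card W + 1)) with hη
  have hη₀ : 0 < η := by positivity
  have hηε : η ≤ ε / 8 := min_le_left _ _
  have hηa : (2 * card W + 1) * η ≤ a ^ card W := by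
    rw [mul_comm, ← le_div_iff₀ (by positivity)]
    exact min_le_right _ _
  set l := ⌈4 / ε⌉₊ with hl
  set M := SzemerediRegularity.bound η l with hM
  have hM₀ : 0 < M := SzemerediRegularity.bound_pos _ _
  -- The last bound gives every part at least `1 / η` vertices.
  refine ⟨max 1 (max l ⌈2 * M / η⌉₊), fun V _ G hV hG ↦ ?_⟩
  simp only [max_le_iff, Nat.ceil_le] at hV
  obtain ⟨hV₁, hVl, hVM⟩ := hV
  have : Nonempty V := Fintype.card_pos_iff.1 hV₁
  obtain ⟨P, hP, hPl, hPM, hPη⟩ := szemeredi_regularity G hη₀ hVl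
  refine ⟨G.regularityReduced P η (ε / 4), regularityReduced_le, ?_, ?_⟩
  · rintro ⟨φ⟩
    obtain ⟨c⟩ := hH
    have hpart : ∀ w w', H.Adj w w' → G.IsUniform η (P.part (φ (c w))) (P.part (φ (c w'))) ∧
        ε / 4 ≤ G.edgeDensity (P.part (φ (c w))) (P.part (φ (c w'))) := by
      intro w w' h
      have hadj : (G.regularityReduced P η (ε / 4)).Adj (φ (c w)) (φ (c w')) :=
        φ.toHom.map_adj (c.valid h)
      obtain ⟨-, X, hX, Y, hY, hx, hy, -, hu, hd⟩ := hadj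
      rw [P.part_eq_of_mem hX hx, P.part_eq_of_mem hY hy]
      exact ⟨hu, hd⟩
    -- Vertices of `H` with the same color are sent to the same part.
    refine hG (isContained_of_isUniform ha₀ (by linarith) hη₀
      (U := fun w ↦ P.part (φ (c w))) (fun w ↦ ?_) hηa (fun w w' h ↦ (hpart w w' h).1)
      fun w w' h ↦ le_trans (by linarith) (hpart w w' h).2)
    have h₁ := card_div_two_mul_le_card_of_mem_parts hP hPM
      (P.part_mem.2 (mem_univ (φ (c w))))
    rw [mul_comm, ← div_le_iff₀ hη₀]
    refine le_trans ?_ h₁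
    rw [le_div_iff₀ (by positivity)]
    refine le_trans (le_of_eq ?_) hVM
    ring
  · have := card_edgeFinset_le_card_edgeFinset_regularityReduced_add hη₀ hηε hP hPη
      ((Nat.le_ceil _).trans (mod_cast hPl))
    rwa [Set.ncard_eq_toFinset_card' G.edgeSet,
      Set.ncard_eq_toFinset_card' (G.regularityReduced P η (ε / 4)).edgeSet]

end Removal

end SimpleGraph

namespace MeanRamseyTuran

open Finset SimpleGraph

/-! ### Losses summed over the colors of a mean coloring -/

section Coloring

variable {V W W' : Type*} {G : SimpleGraph V}

lemma HasMonoCopy.mono {C : G.EdgeLabeling ℕ} {H : SimpleGraph W} {K : SimpleGraph W'}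
    (hKH : K.IsContained H) (hC : HasMonoCopy C H) : HasMonoCopy C K :=
  hC.imp fun _ h ↦ hKH.trans h

lemma colorsAt_subset_range (C : G.EdgeLabeling ℕ) (v : V) : colorsAt C v ⊆ Set.range C := by
  rintro c ⟨w, hw⟩
  obtain ⟨h, rfl⟩ := (EdgeLabeling.labelGraph_adj v w).1 hw
  exact ⟨_, rfl⟩

lemma finite_colorsAt [Finite V] (C : G.EdgeLabeling ℕ) (v : V) : (colorsAt C v).Finite :=
  (Set.finite_range C).subset (colorsAt_subset_range C v)

lemma IsMean.mono [Fintype V] {G' : SimpleGraph V} {ρ : ℝ} {C : G.EdgeLabeling ℕ}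
    {C' : G'.EdgeLabeling ℕ} (hC : IsMean ρ C)
    (hle : ∀ c, C'.labelGraph c ≤ C.labelGraph c) : IsMean ρ C' := by
  refine le_trans (Finset.sum_le_sum fun v _ ↦ ?_) hC
  have hsub : colorsAt C' v ⊆ colorsAt C v := fun c ⟨w, hw⟩ ↦ ⟨w, hle c hw⟩
  exact_mod_cast Set.ncard_le_ncard hsub (finite_colorsAt C v)

open Classical in
/-- The number of edges of color `c` is at most the square of the number of vertices incident with
an edge of color `c`. -/
lemma ncard_edgeSet_labelGraph_le [Fintype V] (C : G.EdgeLabeling ℕ) (c : ℕ) :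
    (C.labelGraph c).edgeSet.ncard ≤ #{v | c ∈ colorsAt C v} ^ 2 := by
  set S : Finset V := {v | c ∈ colorsAt C v}
  have hsub : (C.labelGraph c).edgeSet ⊆
      ((S ×ˢ S).image fun p ↦ s(p.1, p.2) : Finset (Sym2 V)) := by
    intro e he
    induction e using Sym2.ind with
    | _ x y =>
      rw [SimpleGraph.mem_edgeSet] at he
      rw [coe_image]
      exact ⟨(x, y), by simpa [S] using ⟨⟨y, he⟩, ⟨x, he.symm⟩⟩, rfl⟩
  refine (Set.ncard_le_ncard hsub (Finset.finite_toSet _)).trans ?_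
  rw [Set.ncard_coe_finset]
  exact card_image_le.trans (by rw [card_product, sq])

open Classical in
lemma sum_card_filter_mem_colorsAt_le [Fintype V] (C : G.EdgeLabeling ℕ) (S : Finset ℕ) :
    ∑ c ∈ S, #{v | c ∈ colorsAt C v} ≤ ∑ v, (colorsAt C v).ncard := by
  have := sum_card_bipartiteAbove_eq_sum_card_bipartiteBelow (s := S) (t := (univ : Finset V))
    (fun c v ↦ c ∈ colorsAt C v)
  unfold bipartiteAbove bipartiteBelow at this
  rw [this]
  refine Finset.sum_le_sum fun v _ ↦ ?_
  rw [← Set.ncard_coe_finset]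
  exact Set.ncard_le_ncard (fun c hc ↦ (mem_filter.1 (mem_coe.1 hc)).2) (finite_colorsAt C v)

/-- A coloring whose color classes are subgraphs of those of `C` is obtained by restricting `C` to
the union of these subgraphs. -/
lemma exists_labelGraph_le_of_le (C : G.EdgeLabeling ℕ) {F : ℕ → SimpleGraph V}
    (hF : ∀ c, F c ≤ C.labelGraph c) :
    ∃ C' : (⨆ c, F c).EdgeLabeling ℕ, ∀ c, C'.labelGraph c ≤ F c := by
  have hle : ⨆ c, F c ≤ G := iSup_le fun c ↦ (hF c).trans (EdgeLabeling.labelGraph_le C)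
  refine ⟨fun e ↦ C ⟨e.1, edgeSet_mono hle e.2⟩, fun c v w h ↦ ?_⟩
  obtain ⟨h, hc⟩ := (EdgeLabeling.labelGraph_adj v w).1 h
  obtain ⟨c', hc'⟩ := iSup_adj.1 h
  obtain ⟨h'', hc''⟩ := (EdgeLabeling.labelGraph_adj v w).1 (hF c' hc')
  have : c' = c := hc''.symm.trans hc
  exact this ▸ hc'

open Classical in
/-- If the subgraphs `F c` of the color classes of `C` each miss at most `(d * #V) ^ 2` edges of
their color, then the union of these subgraphs misses few edges of a mean coloring, however many
colors there are. -/
lemma ncard_edgeSet_le_of_isMean [Fintype V] {ρ d : ℝ} (hd : 0 ≤ d) {C : G.EdgeLabeling ℕ}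
    (hC : IsMean ρ C) {F : ℕ → SimpleGraph V} (hF : ∀ c, F c ≤ C.labelGraph c)
    (hcard : ∀ c, ((C.labelGraph c).edgeSet.ncard : ℝ) ≤
      (F c).edgeSet.ncard + d ^ 2 * Fintype.card V ^ 2) :
    (G.edgeSet.ncard : ℝ) ≤ (⨆ c, F c).edgeSet.ncard + d * ρ * Fintype.card V ^ 2 := by
  set n : ℝ := (Fintype.card V : ℝ) with hn
  have hn₀ : 0 ≤ n := Nat.cast_nonneg _
  have hlost : ∀ c, (((C.labelGraph c).edgeSet \ (F c).edgeSet).ncard : ℝ) ≤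
      d * n * #{v | c ∈ colorsAt C v} := by
    intro c
    -- Widely seen colors use the removal bound, the others the trivial square bound.
    rcases le_total (d * n) #{v | c ∈ colorsAt C v} with h | h
    · have h₁ := Set.ncard_sdiff_add_ncard_of_subset (edgeSet_mono (hF c)) (Set.toFinite _)
      have h₂ : (((C.labelGraph c).edgeSet \ (F c).edgeSet).ncard : ℝ) + (F c).edgeSet.ncard =
        (C.labelGraph c).edgeSet.ncard := by exact_mod_cast h₁
      have h₃ := mul_le_mul_of_nonneg_left h (mul_nonneg hd hn₀)
      have h₄ := hcard c
      nlinarith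
    · have h₁ : (((C.labelGraph c).edgeSet \ (F c).edgeSet).ncard : ℝ) ≤
          (#{v | c ∈ colorsAt C v} : ℝ) ^ 2 := by
        exact_mod_cast (Set.ncard_le_ncard Set.sdiff_subset (Set.toFinite _)).trans
          (ncard_edgeSet_labelGraph_le C c)
      refine h₁.trans ?_
      rw [sq]
      gcongr
  have hfin : (Set.range C).Finite := Set.finite_range C
  have hsub : G.edgeSet ⊆ (⨆ c, F c).edgeSet ∪
      ⋃ c ∈ hfin.toFinset, ((C.labelGraph c).edgeSet \ (F c).edgeSet) := by
    intro e he
    by_cases h : e ∈ (⨆ c, F c).edgeSet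
    · exact Or.inl h
    · refine Or.inr ?_
      have hc : e ∈ (C.labelGraph (C ⟨e, he⟩)).edgeSet := by
        induction e using Sym2.ind with
        | _ x y => exact (EdgeLabeling.labelGraph_adj x y).2 ⟨he, rfl⟩
      simp only [Set.mem_iUnion]
      exact ⟨C ⟨e, he⟩, hfin.mem_toFinset.2 ⟨_, rfl⟩, hc,
        fun h' ↦ h (edgeSet_mono (le_iSup F _) h')⟩
  have h₁ : (G.edgeSet.ncard : ℝ) ≤ (⨆ c, F c).edgeSet.ncard +
      ∑ c ∈ hfin.toFinset, (((C.labelGraph c).edgeSet \ (F c).edgeSet).ncard : ℝ) := by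
    exact_mod_cast (Set.ncard_le_ncard hsub (Set.toFinite _)).trans
      ((Set.ncard_union_le _ _).trans (Nat.add_le_add_left (Finset.set_ncard_biUnion_le _ _) _))
  have h₂ : ∑ c ∈ hfin.toFinset, (#{v | c ∈ colorsAt C v} : ℝ) ≤ ρ * n := by
    refine le_trans ?_ hC
    exact_mod_cast sum_card_filter_mem_colorsAt_le C hfin.toFinset
  calc
    (G.edgeSet.ncard : ℝ) ≤ (⨆ c, F c).edgeSet.ncard +
        ∑ c ∈ hfin.toFinset, d * n * (#{v | c ∈ colorsAt C v} : ℝ) :=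
      h₁.trans (by gcongr with c _; exact hlost c)
    _ ≤ (⨆ c, F c).edgeSet.ncard + d * n * (ρ * n) := by
      rw [← Finset.mul_sum]
      gcongr
    _ = (⨆ c, F c).edgeSet.ncard + d * ρ * n ^ 2 := by ring

end Coloring

/-! ### Comparison of Ramsey-Turán numbers -/

section RT

variable {W W' : Type*}

lemma bddAbove_ncard_edgeSet (n : ℕ) (H : SimpleGraph W) (ρ : ℝ) :
    BddAbove {m : ℕ | ∃ (G : SimpleGraph (Fin n)) (C : G.EdgeLabeling ℕ),
      IsMean ρ C ∧ ¬ HasMonoCopy C H ∧ G.edgeSet.ncard = m} := by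
  refine ⟨(Set.univ : Set (Sym2 (Fin n))).ncard, ?_⟩
  rintro _ ⟨G, -, -, -, rfl⟩
  exact Set.ncard_le_ncard (Set.subset_univ _)

lemma ncard_edgeSet_le_RT {n : ℕ} {H : SimpleGraph W} {ρ : ℝ} {G : SimpleGraph (Fin n)}
    {C : G.EdgeLabeling ℕ} (hC : IsMean ρ C) (hH : ¬ HasMonoCopy C H) :
    G.edgeSet.ncard ≤ RT n H ρ :=
  le_csSup (bddAbove_ncard_edgeSet n H ρ) ⟨G, C, hC, hH, rfl⟩

lemma RT_eq_zero_or_exists (n : ℕ) (H : SimpleGraph W) (ρ : ℝ) :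
    RT n H ρ = 0 ∨ ∃ (G : SimpleGraph (Fin n)) (C : G.EdgeLabeling ℕ),
      IsMean ρ C ∧ ¬ HasMonoCopy C H ∧ G.edgeSet.ncard = RT n H ρ := by
  rcases Set.eq_empty_or_nonempty {m : ℕ | ∃ (G : SimpleGraph (Fin n)) (C : G.EdgeLabeling ℕ),
      IsMean ρ C ∧ ¬ HasMonoCopy C H ∧ G.edgeSet.ncard = m} with h | h
  · left
    rw [RT, h, csSup_empty, bot_eq_zero]
  · exact Or.inr (Nat.sSup_mem h (bddAbove_ncard_edgeSet n H ρ))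

lemma RT_mono (n : ℕ) {H : SimpleGraph W} {K : SimpleGraph W'} (hKH : K.IsContained H) (ρ : ℝ) :
    RT n K ρ ≤ RT n H ρ := by
  rcases RT_eq_zero_or_exists n K ρ with h | ⟨G, C, hC, hK, h⟩
  · rw [h]
    exact Nat.zero_le _
  · rw [← h]
    exact ncard_edgeSet_le_RT hC fun hH ↦ hK (hH.mono hKH)

theorem RT_le_RT_completeGraph_add [Finite W] {H : SimpleGraph W} {k : ℕ} (hH : H.Colorable k)
    {ρ ε : ℝ} (hρ : 0 < ρ) (hε : 0 < ε) :
    ∃ N : ℕ, ∀ n ≥ N, (RT n H ρ : ℝ) ≤ RT n (completeGraph (Fin k)) ρ + ε * n ^ 2 := by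
  have hd : 0 < ε / ρ := div_pos hε hρ
  obtain ⟨N, hN⟩ := hH.exists_le_completeGraph_free (pow_pos hd 2)
  refine ⟨N, fun n hn ↦ ?_⟩
  rcases RT_eq_zero_or_exists n H ρ with h | ⟨G, C, hC, hCH, h⟩
  · rw [h, Nat.cast_zero]
    positivity
  -- The threshold `N` does not depend on the graph, so it serves all colors at once.
  choose F hF hfree hcard using fun c ↦ hN (Fin n) (C.labelGraph c) (by simpa using hn)
    fun hc ↦ hCH ⟨c, hc⟩
  obtain ⟨C', hC'⟩ := exists_labelGraph_le_of_le C hF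
  have hK : ¬ HasMonoCopy C' (completeGraph (Fin k)) := fun ⟨c, hc⟩ ↦
    hfree c (hc.mono_right (hC' c))
  have h₁ : ((⨆ c, F c).edgeSet.ncard : ℝ) ≤ RT n (completeGraph (Fin k)) ρ := by
    exact_mod_cast ncard_edgeSet_le_RT (hC.mono fun c ↦ (hC' c).trans (hF c)) hK
  have h₂ := ncard_edgeSet_le_of_isMean hd.le hC hF hcard
  rw [div_mul_cancel₀ _ hρ.ne', Fintype.card_fin] at h₂
  rw [← h]
  linarith

end RT

end MeanRamseyTuran

theorem theorem2 {W : Type*} [Finite W] (H : SimpleGraph W) (ρ : ℝ) (hρ : 1 ≤ ρ) :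
    (∃ f : ℕ → ℝ, f =o[atTop] (fun n : ℕ => (n : ℝ) ^ 2) ∧
      ∀ n : ℕ, (MeanRamseyTuran.RT n H ρ : ℝ) ≤
        MeanRamseyTuran.RT n (SimpleGraph.completeGraph (Fin H.chromaticNumber.toNat)) ρ + f n) ∧
    ((H.cliqueNum : ℕ∞) = H.chromaticNumber →
      ∃ f : ℕ → ℝ, f =o[atTop] (fun n : ℕ => (n : ℝ) ^ 2) ∧
        ∀ n : ℕ, (MeanRamseyTuran.RT n H ρ : ℝ) =
          MeanRamseyTuran.RT n (SimpleGraph.completeGraph (Fin H.chromaticNumber.toNat)) ρ + f n) := by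
  set K := SimpleGraph.completeGraph (Fin H.chromaticNumber.toNat)
  have hupper : ∀ ε : ℝ, 0 < ε → ∀ᶠ n : ℕ in atTop,
      (MeanRamseyTuran.RT n H ρ : ℝ) - MeanRamseyTuran.RT n K ρ ≤ ε * (n : ℝ) ^ 2 := by
    intro ε hε
    obtain ⟨N, hN⟩ := MeanRamseyTuran.RT_le_RT_completeGraph_add
      H.colorable_chromaticNumber_of_fintype (by linarith : 0 < ρ) hε
    filter_upwards [eventually_ge_atTop N] with n hn
    linarith [hN n hn]
  -- The difference itself has only an upper bound in general, hence the positive part; in the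
  -- clique case the two agree.
  have hlittle : (fun n : ℕ ↦ max 0 ((MeanRamseyTuran.RT n H ρ : ℝ) -
      MeanRamseyTuran.RT n K ρ)) =o[atTop] (fun n : ℕ => (n : ℝ) ^ 2) := by
    refine isLittleO_iff.2 fun ε hε ↦ ?_
    filter_upwards [hupper ε hε] with n hn
    rw [Real.norm_of_nonneg (le_max_left _ _), Real.norm_of_nonneg (by positivity)]
    exact max_le (by positivity) hn
  refine ⟨⟨_, hlittle, fun n ↦ ?_⟩, fun hclique ↦ ⟨_, hlittle, fun n ↦ ?_⟩⟩
  · linarith [le_max_right 0 ((MeanRamseyTuran.RT n H ρ : ℝ) - MeanRamseyTuran.RT n K ρ)]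
  · have hKH : K.IsContained H := by
      have hnum : H.chromaticNumber.toNat = H.cliqueNum := by rw [← hclique, ENat.toNat_natCast]
      obtain ⟨s, hs⟩ := H.exists_isNClique_cliqueNum
      rw [← hnum] at hs
      exact (SimpleGraph.not_cliqueFree_iff_top_isContained _).1 hs.not_cliqueFree
    have : (MeanRamseyTuran.RT n K ρ : ℝ) ≤ MeanRamseyTuran.RT n H ρ := by
      exact_mod_cast MeanRamseyTuran.RT_mono n hKH ρ
    rw [max_eq_right (sub_nonneg.2 this)]
    ring
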